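/- Let $0\le N_O\le N$ and let $\Sigma_1,\Sigma_2$ be real symmetric positive definite $N\times N$ matrices. For positive definite $n\times n$ matrices $S,T$ let $$D(S\|T)=\tfrac12\ln\frac{|T|}{|S|}+\tfrac12\operatorname{tr}(T^{-1}S)-\tfrac n2$$ be the relative entropy of the centred Gaussian distributions $N(0,S)$ and $N(0,T)$. For positive definite $S_1,S_2$ put $S_\lambda^{-1}=\lambda S_1^{-1}+(1-\lambda)S_2^{-1}$, and let the Chernoff information be $CI(S_1\|S_2)=D(S_{\lambda^*}\|S_2)=D(S_{\lambda^*}\|S_1)$, where $\lambda^*\in[0,1]$ is a point at which the two relative entropies agree (it exists, and it is unique unless $S_1=S_2$, when every point gives the value $0$). The matrix $\Sigma_1\Sigma_2^{-1}$ has an eigenvalue decomposition $Q\Lambda Q^{-1}$ with $Q$ real and invertible and $\Lambda=\operatorname{Diag}(\lambda_1,\dots,\lambda_N)$ real. Take any such decomposition, and let $$P=\bigl(Q^{-1}\Sigma_2(Q^{-1})^T\bigr)^{-1/2}Q^{-1}.$$ Then $P\Sigma_2P^T=I_N$ and $P\Sigma_1P^T=\Lambda$. Let $m$ be the number of indices $i$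 with $\lambda_i>1$. Fix any ordering of the indices in which the eigenvalues are decreasing (ties broken arbitrarily). For $0\le k\le N_O$ let $A_k$ be the $N_O\times N$ matrix that consists of the rows of $P$ that correspond to the $k$ largest and the $N_O-k$ smallest eigenvalues (the first $k$ and the last $N_O-k$ in that ordering). Then there is a $k$ with $0\le k\le N_O$ and $N_O+m-N\le k\le m$ such that $A_k$ has rank $N_O$ and maximizes the Chernoff information of the projected Gaussians among all $N_O\times N$ matrices of full row rank: $$CI(A\Sigma_1A^T\|A\Sigma_2A^T)\le CI(A_k\Sigma_1A_k^T\|A_k\Sigma_2A_k^T)\qquad\text{for all }A\in\mathbb R^{N_O\times N}\text{ with }\operatorname{rank}A=N_O .$$ The same inequality holds, with the same $k$, for every $r\le N_O$ and every $r\times N$ matrix $A$ of rank $r$. (This covers rank-deficient $N_O\times N$ matrices: their output is a Gaussian vector on an $r$-dimensional subspace, and it is described there by such an $A$.) -/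

import Mathlib

open scoped MatrixOrder

noncomputable section

namespace GaussianDR

/-- The relative entropy `D(S‖T)` of the centred Gaussian law `N(0, S)` with respect to `N(0, T)`,
for positive definite `n × n` covariance matrices `S` and `T`. -/
def relEntropy {n : ℕ} (S T : Matrix (Fin n) (Fin n) ℝ) : ℝ :=
  1 / 2 * Real.log (T.det / S.det) + 1 / 2 * (T⁻¹ * S).trace - n / 2

/-- The covariance matrix `S_l` with `S_l⁻¹ = l S₁⁻¹ + (1 - l) S₂⁻¹`, a point of the exponential
family through `N(0, S₁)` and `N(0, S₂)`. -/
def mixCov {n : ℕ} (S₁ S₂ : Matrix (Fin n) (Fin n) ℝ) (l : ℝ) : Matrix (Fin n) (Fin n) ℝ :=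
  (l • S₁⁻¹ + (1 - l) • S₂⁻¹)⁻¹

open Classical in
/-- The Chernoff information of `N(0, S₁)` and `N(0, S₂)`: the common value
`D(S_l‖S₂) = D(S_l‖S₁)` at a point `l ∈ [0, 1]` where the two relative entropies agree.
For positive definite matrices such an `l` exists, and it is unique unless `S₁ = S₂`, in which
case every `l` gives the value `0`; the `else` branch is therefore never used for them. -/
def chernoffInfo {n : ℕ} (S₁ S₂ : Matrix (Fin n) (Fin n) ℝ) : ℝ :=
  if h : ∃ l ∈ Set.Icc (0 : ℝ) 1,
      relEntropy (mixCov S₁ S₂ l) S₂ = relEntropy (mixCov S₁ S₂ l) S₁ then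
    relEntropy (mixCov S₁ S₂ h.choose) S₂
  else 0

/-- The Chernoff information of the laws of `A x` under `x ∼ N(0, S₁)` and `x ∼ N(0, S₂)`. -/
def projectedChernoffInfo {r N : ℕ} (S₁ S₂ : Matrix (Fin N) (Fin N) ℝ)
    (A : Matrix (Fin r) (Fin N) ℝ) : ℝ :=
  chernoffInfo (A * S₁ * A.transpose) (A * S₂ * A.transpose)

/-- `S₁ S₂⁻¹ = Q Λ Q⁻¹` with `Q` invertible and `Λ = diag(lam)`; thus `lam` lists the generalized
eigenvalues of `S₁` and `S₂` with multiplicity. -/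
def IsEigendecomposition {N : ℕ} (S₁ S₂ Q : Matrix (Fin N) (Fin N) ℝ) (lam : Fin N → ℝ) : Prop :=
  IsUnit Q ∧ S₁ * S₂⁻¹ = Q * Matrix.diagonal lam * Q⁻¹

/-- The transform `P = (Q⁻¹ S₂ Q⁻ᵀ)^(-1/2) Q⁻¹`. -/
def diagTransform {N : ℕ} (S₂ Q : Matrix (Fin N) (Fin N) ℝ) : Matrix (Fin N) (Fin N) ℝ :=
  (CFC.sqrt (Q⁻¹ * S₂ * (Q⁻¹).transpose))⁻¹ * Q⁻¹

/-- Among the positions `0, …, N - 1`, the first `k` and the last `M - k`, in increasing order. -/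
def endsIndex {M N : ℕ} (hM : M ≤ N) (k : ℕ) (i : Fin M) : Fin N :=
  if (i : ℕ) < k then ⟨i, by omega⟩ else ⟨N - M + i, by omega⟩

/-- The matrix `A_k`: the rows of `P` whose positions in the list `lam ∘ σ` are the first `k` and
the last `M - k`. When `σ` sorts `lam` in decreasing order, these are the rows that belong to the
`k` largest and the `M - k` smallest entries of `lam`. -/
def endsMatrix {M N : ℕ} (hM : M ≤ N) (P : Matrix (Fin N) (Fin N) ℝ) (σ : Equiv.Perm (Fin N))
    (k : ℕ) : Matrix (Fin M) (Fin N) ℝ :=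
  P.submatrix (fun i => σ (endsIndex hM k i)) id

/-- The number of entries of `lam` that are greater than one. -/
def countGtOne {N : ℕ} (lam : Fin N → ℝ) : ℕ :=
  (Finset.univ.filter fun i => 1 < lam i).card

end GaussianDR

end

namespace GaussianDR

open Matrix

/-! ### Invariance under an invertible change of coordinates -/

section Congruence

variable {n : ℕ} {B : Matrix (Fin n) (Fin n) ℝ}

/-! Congruence reduces a pair of covariances to `diagonal v` and `1`. There the Chernoff information
is the maximum over `l ∈ [0, 1]` of half the sum of `chernoffExponent l (v i)`
(`isGreatest_chernoffInfo`). For each fixed `l` this exponent is nonnegative and grows as its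
argument moves away from one (`chernoffExponent_mono`).

The generalized eigenvalues `b` of a projected pair interlace those of the full pair
(`compression_eigenvalue_le`, `le_compression_eigenvalue`). Hence those above one are dominated by
the largest `lam`, the others by the smallest, and the two groups can be matched with distinct rows
of some `A_k` (`sum_chernoffExponent_le`). The comparison holds at every `l`, so it passes to the
maximum. The cut `k` depends on the projection, but only finitely many cuts are admissible, and the
best of them serves all projections. -/

theorem relEntropy_congruence (hB : IsUnit B) (S T : Matrix (Fin n) (Fin n) ℝ) :
    relEntropy (B * S * Bᵀ) (B * T * Bᵀ) = relEntropy S T := by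
  have hd : IsUnit B.det := (isUnit_iff_isUnit_det B).1 hB
  have hdt : IsUnit Bᵀ.det := by rwa [det_transpose]
  have htr : ((B * T * Bᵀ)⁻¹ * (B * S * Bᵀ)).trace = (T⁻¹ * S).trace := by
    have h : (B * T * Bᵀ)⁻¹ * (B * S * Bᵀ) = Bᵀ⁻¹ * (T⁻¹ * S * Bᵀ) := by
      rw [Matrix.mul_inv_rev, Matrix.mul_inv_rev]
      simp only [Matrix.mul_assoc]
      rw [nonsing_inv_mul_cancel_left _ _ hd]
    rw [h, Matrix.trace_mul_comm, mul_nonsing_inv_cancel_right _ _ hdt]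
  have hdet : (B * T * Bᵀ).det / (B * S * Bᵀ).det = T.det / S.det := by
    have h0 : B.det ≠ 0 := hd.ne_zero
    simp only [det_mul, det_transpose]
    rw [mul_div_mul_right _ _ h0, mul_div_mul_left _ _ h0]
  rw [relEntropy, relEntropy, htr, hdet]

theorem mixCov_congruence (hB : IsUnit B) (S₁ S₂ : Matrix (Fin n) (Fin n) ℝ) (l : ℝ) :
    mixCov (B * S₁ * Bᵀ) (B * S₂ * Bᵀ) l = B * mixCov S₁ S₂ l * Bᵀ := by
  have hd : IsUnit B.det := (isUnit_iff_isUnit_det B).1 hB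
  have hdt : IsUnit Bᵀ.det := by rwa [det_transpose]
  have h : l • (B * S₁ * Bᵀ)⁻¹ + (1 - l) • (B * S₂ * Bᵀ)⁻¹
      = Bᵀ⁻¹ * (l • S₁⁻¹ + (1 - l) • S₂⁻¹) * B⁻¹ := by
    simp only [Matrix.mul_inv_rev, Matrix.mul_add, Matrix.add_mul, Matrix.mul_smul,
      Matrix.smul_mul, Matrix.mul_assoc]
  rw [mixCov, h, Matrix.mul_inv_rev, Matrix.mul_inv_rev, nonsing_inv_nonsing_inv _ hd,
    nonsing_inv_nonsing_inv _ hdt, mixCov, Matrix.mul_assoc]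

theorem chernoffInfo_congruence (hB : IsUnit B) (S₁ S₂ : Matrix (Fin n) (Fin n) ℝ) :
    chernoffInfo (B * S₁ * Bᵀ) (B * S₂ * Bᵀ) = chernoffInfo S₁ S₂ := by
  classical
  -- With the value written as a function of the two entropy curves, equal curves give the same
  -- chosen point; uniqueness of that point is not needed.
  let K : (ℝ → ℝ) → (ℝ → ℝ) → ℝ := fun f g =>
    if h : ∃ l ∈ Set.Icc (0 : ℝ) 1, f l = g l then f h.choose else 0
  have hK : ∀ T₁ T₂ : Matrix (Fin n) (Fin n) ℝ, chernoffInfo T₁ T₂ =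
      K (fun l => relEntropy (mixCov T₁ T₂ l) T₂) (fun l => relEntropy (mixCov T₁ T₂ l) T₁) := by
    intro T₁ T₂
    simp only [chernoffInfo, K]
  rw [hK, hK]
  simp only [mixCov_congruence hB, relEntropy_congruence hB]

end Congruence

/-! ### Chernoff information of a diagonal pair -/

section Diagonal

variable {n : ℕ}

theorem diagonal_inv {v : Fin n → ℝ} (hv : ∀ i, 0 < v i) :
    (diagonal v)⁻¹ = diagonal fun i => (v i)⁻¹ := by
  apply inv_eq_right_inv
  rw [diagonal_mul_diagonal, ← diagonal_one]
  congr 1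
  funext i
  exact mul_inv_cancel₀ (hv i).ne'

theorem relEntropy_diagonal {s t : Fin n → ℝ} (hs : ∀ i, 0 < s i) (ht : ∀ i, 0 < t i) :
    relEntropy (diagonal s) (diagonal t)
      = 1 / 2 * ∑ i, (Real.log (t i) - Real.log (s i) + s i / t i - 1) := by
  rw [relEntropy, diagonal_inv ht, diagonal_mul_diagonal, trace_diagonal, det_diagonal,
    det_diagonal, Real.log_div (Finset.prod_ne_zero_iff.2 fun i _ => (ht i).ne')
      (Finset.prod_ne_zero_iff.2 fun i _ => (hs i).ne'),
    Real.log_prod (fun i _ => (ht i).ne'), Real.log_prod (fun i _ => (hs i).ne')]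
  simp only [Finset.sum_sub_distrib, Finset.sum_add_distrib, Finset.sum_const, Finset.card_univ,
    Fintype.card_fin, nsmul_eq_mul, mul_one, div_eq_inv_mul]
  ring

/-- The precision, relative to the second law, of the point `l` of the exponential family through
`N(0, x)` and `N(0, 1)`. -/
noncomputable def mixPrecision (l x : ℝ) : ℝ := l / x + (1 - l)

theorem mixPrecision_pos {l x : ℝ} (hl : l ∈ Set.Icc (0 : ℝ) 1) (hx : 0 < x) :
    0 < mixPrecision l x := by
  obtain ⟨h0, h1⟩ := hl
  rw [mixPrecision]
  rcases h0.eq_or_lt with rfl | h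
  · simp
  · have := div_pos h hx
    linarith

/-- Twice the Chernoff exponent at `l` of the scalar laws `N(0, x)` and `N(0, 1)`. -/
noncomputable def chernoffExponent (l x : ℝ) : ℝ := Real.log (mixPrecision l x) + l * Real.log x

theorem mixCov_diagonal_one {v : Fin n → ℝ} (hv : ∀ i, 0 < v i) {l : ℝ}
    (hl : l ∈ Set.Icc (0 : ℝ) 1) :
    mixCov (diagonal v) 1 l = diagonal fun i => (mixPrecision l (v i))⁻¹ := by
  rw [mixCov, diagonal_inv hv, inv_one, ← diagonal_one, ← diagonal_smul, ← diagonal_smul,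
    diagonal_add, ← diagonal_inv fun i => mixPrecision_pos hl (hv i)]
  congr 2
  funext i
  simp [mixPrecision, div_eq_mul_inv]

theorem relEntropy_mixCov_one {v : Fin n → ℝ} (hv : ∀ i, 0 < v i) {l : ℝ}
    (hl : l ∈ Set.Icc (0 : ℝ) 1) :
    relEntropy (mixCov (diagonal v) 1 l) 1
      = 1 / 2 * ∑ i, (Real.log (mixPrecision l (v i)) + (mixPrecision l (v i))⁻¹ - 1) := by
  rw [mixCov_diagonal_one hv hl, ← diagonal_one,
    relEntropy_diagonal (fun i => inv_pos.2 (mixPrecision_pos hl (hv i))) fun _ => one_pos]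
  simp

theorem relEntropy_mixCov_diagonal {v : Fin n → ℝ} (hv : ∀ i, 0 < v i) {l : ℝ}
    (hl : l ∈ Set.Icc (0 : ℝ) 1) :
    relEntropy (mixCov (diagonal v) 1 l) (diagonal v)
      = 1 / 2 * ∑ i, (Real.log (v i) + Real.log (mixPrecision l (v i))
        + (mixPrecision l (v i))⁻¹ / v i - 1) := by
  rw [mixCov_diagonal_one hv hl,
    relEntropy_diagonal (fun i => inv_pos.2 (mixPrecision_pos hl (hv i))) hv]
  simp

/-- A convex combination of the divergences from `N(0, 1/w)` to `N(0, x)` and `N(0, 1)` is at least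
the Chernoff exponent, with equality when `w` is the precision of the mixture. -/
theorem chernoffExponent_le {l x w : ℝ} (hl : l ∈ Set.Icc (0 : ℝ) 1) (hx : 0 < x) (hw : 0 < w) :
    chernoffExponent l x ≤ l * (Real.log x + Real.log w + w⁻¹ / x - 1)
      + (1 - l) * (Real.log w + w⁻¹ - 1) := by
  have hp := mixPrecision_pos hl hx
  -- With `u = mixPrecision l x / w`, the gap between the two sides is `u - 1 - log u`.
  have h := Real.log_le_sub_one_of_pos (div_pos hp hw)
  rw [Real.log_div hp.ne' hw.ne'] at h
  have e : mixPrecision l x / w = l * (w⁻¹ / x) + (1 - l) * w⁻¹ := by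
    rw [mixPrecision]; field_simp
  rw [chernoffExponent]
  linear_combination h + e

theorem chernoffExponent_eq {l x : ℝ} (hl : l ∈ Set.Icc (0 : ℝ) 1) (hx : 0 < x) :
    chernoffExponent l x
      = l * (Real.log x + Real.log (mixPrecision l x) + (mixPrecision l x)⁻¹ / x - 1)
        + (1 - l) * (Real.log (mixPrecision l x) + (mixPrecision l x)⁻¹ - 1) := by
  have hp := mixPrecision_pos hl hx
  have e : 1 = l * ((mixPrecision l x)⁻¹ / x) + (1 - l) * (mixPrecision l x)⁻¹ := by
    rw [← mul_inv_cancel₀ hp.ne']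
    nth_rw 1 [mixPrecision]
    field_simp
  rw [chernoffExponent]
  linear_combination e

theorem exists_relEntropy_eq {v : Fin n → ℝ} (hv : ∀ i, 0 < v i) :
    ∃ l ∈ Set.Icc (0 : ℝ) 1, relEntropy (mixCov (diagonal v) 1 l) 1
      = relEntropy (mixCov (diagonal v) 1 l) (diagonal v) := by
  -- `f` is twice the difference of the two relative entropies. The mixture is the second law at `l
  -- = 0` and the first at `l = 1`, which fixes the signs there.
  set f : ℝ → ℝ := fun l => ∑ i, ((mixPrecision l (v i))⁻¹ * (1 - 1 / v i) - Real.log (v i))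
    with hf
  have hcont : ContinuousOn f (Set.Icc 0 1) := by
    refine continuousOn_finsetSum _ fun i _ => ?_
    refine ContinuousOn.sub (ContinuousOn.mul (ContinuousOn.inv₀ ?_ fun l hl =>
      (mixPrecision_pos hl (hv i)).ne') continuousOn_const) continuousOn_const
    unfold mixPrecision
    fun_prop
  have h0 : f 0 ≤ 0 := by
    refine Finset.sum_nonpos fun i _ => ?_
    have := Real.one_sub_inv_le_log_of_pos (hv i)
    simp only [mixPrecision, zero_div, sub_zero, zero_add, inv_one, one_mul, one_div]
    linarith
  have h1 : 0 ≤ f 1 := by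
    refine Finset.sum_nonneg fun i _ => ?_
    have := Real.log_le_sub_one_of_pos (hv i)
    simp only [mixPrecision, sub_self, add_zero, one_div, inv_inv, mul_sub, mul_one,
      mul_inv_cancel₀ (hv i).ne']
    linarith
  obtain ⟨l, hl, hfl⟩ := intermediate_value_Icc zero_le_one hcont ⟨h0, h1⟩
  refine ⟨l, hl, ?_⟩
  rw [relEntropy_mixCov_one hv hl, relEntropy_mixCov_diagonal hv hl, ← sub_eq_zero, ← mul_sub,
    ← Finset.sum_sub_distrib, mul_eq_zero]
  right
  rw [← hfl, hf]
  refine Finset.sum_congr rfl fun i _ => ?_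
  ring

/-- The Chernoff information is the largest Chernoff exponent. -/
theorem isGreatest_chernoffInfo {v : Fin n → ℝ} (hv : ∀ i, 0 < v i) :
    IsGreatest ((fun l => 1 / 2 * ∑ i, chernoffExponent l (v i)) '' Set.Icc 0 1)
      (chernoffInfo (diagonal v) 1) := by
  have hex := exists_relEntropy_eq hv
  obtain ⟨hl, heq⟩ := hex.choose_spec
  have hval : chernoffInfo (diagonal v) 1 = relEntropy (mixCov (diagonal v) 1 hex.choose) 1 := by
    rw [chernoffInfo, dif_pos hex]
  set l := hex.choose
  -- The two divergences agree at `l`, so every weighting `c` of them gives the same value: `c = l`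
  -- shows that it is attained, any other `c` that it is an upper bound.
  have hcomb : ∀ c : ℝ, chernoffInfo (diagonal v) 1 = 1 / 2 * ∑ i,
      (c * (Real.log (v i) + Real.log (mixPrecision l (v i)) + (mixPrecision l (v i))⁻¹ / v i - 1)
      + (1 - c) * (Real.log (mixPrecision l (v i)) + (mixPrecision l (v i))⁻¹ - 1)) := by
    intro c
    rw [Finset.sum_add_distrib, ← Finset.mul_sum, ← Finset.mul_sum, hval]
    have h2 := relEntropy_mixCov_one hv hl
    have h1 := relEntropy_mixCov_diagonal hv hl
    rw [← heq] at h1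
    linear_combination c * h1 + (1 - c) * h2
  refine ⟨⟨l, hl, ?_⟩, ?_⟩
  · rw [hcomb l]
    exact congrArg _ (Finset.sum_congr rfl fun i _ => chernoffExponent_eq hl (hv i))
  · rintro _ ⟨c, hc, rfl⟩
    rw [hcomb c]
    exact mul_le_mul_of_nonneg_left (Finset.sum_le_sum fun i _ =>
      chernoffExponent_le hc (hv i) (mixPrecision_pos hl (hv i))) (by norm_num)

/-- The Chernoff exponent increases as its argument moves away from one. -/
theorem chernoffExponent_mono {l x y : ℝ} (hl : l ∈ Set.Icc (0 : ℝ) 1) (hx : 0 < x) (hy : 0 < y)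
    (h : 0 ≤ (x - 1) * (y - x)) : chernoffExponent l x ≤ chernoffExponent l y := by
  obtain ⟨h0, h1⟩ := hl
  have hpx := mixPrecision_pos ⟨h0, h1⟩ hx
  have hpy := mixPrecision_pos ⟨h0, h1⟩ hy
  have hu : 0 < x / y := div_pos hx hy
  have hq : 0 < l * (x / y) + (1 - l) := by
    have := mixPrecision_pos ⟨h0, h1⟩ (inv_pos.2 hu)
    rwa [mixPrecision, div_inv_eq_mul] at this
  -- Put `q = l * (x / y) + (1 - l)`. Concavity of the logarithm bounds `l * (log x - log y)` by
  -- `log q`, and the sign hypothesis gives `mixPrecision l x * q ≤ mixPrecision l y`.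
  have hlog : l * (Real.log x - Real.log y) ≤ Real.log (l * (x / y) + (1 - l)) := by
    have := strictConcaveOn_log_Ioi.concaveOn.2 (Set.mem_Ioi.2 hu) (Set.mem_Ioi.2 one_pos) h0
      (sub_nonneg.2 h1) (by ring)
    rw [← Real.log_div hx.ne' hy.ne']
    simpa using this
  have hprod : mixPrecision l x * (l * (x / y) + (1 - l)) ≤ mixPrecision l y := by
    have e : mixPrecision l y - mixPrecision l x * (l * (x / y) + (1 - l))
        = l * (1 - l) * ((x - 1) * (y - x)) / (x * y) := by
      rw [mixPrecision, mixPrecision]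
      field_simp
      ring
    have : 0 ≤ l * (1 - l) * ((x - 1) * (y - x)) / (x * y) :=
      div_nonneg (mul_nonneg (mul_nonneg h0 (sub_nonneg.2 h1)) h) (mul_pos hx hy).le
    linarith
  have := Real.log_le_log (mul_pos hpx hq) hprod
  rw [Real.log_mul hpx.ne' hq.ne'] at this
  rw [chernoffExponent, chernoffExponent]
  linarith

theorem chernoffExponent_nonneg {l x : ℝ} (hl : l ∈ Set.Icc (0 : ℝ) 1) (hx : 0 < x) :
    0 ≤ chernoffExponent l x := by
  have h := chernoffExponent_mono hl one_pos hx (by simp)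
  simpa [chernoffExponent, mixPrecision] using h

end Diagonal

/-! ### Simultaneous diagonalization and the transform `P` -/

section Diagonalization

variable {n : ℕ}

theorem posDef_congruence {S : Matrix (Fin n) (Fin n) ℝ} (hS : S.PosDef) {r : ℕ}
    {A : Matrix (Fin r) (Fin n) ℝ} (hA : Function.Injective A.vecMul) : (A * S * Aᵀ).PosDef := by
  simpa [conjTranspose_eq_transpose_of_trivial] using hS.mul_mul_conjTranspose_same hA

theorem pos_of_congruence_eq_diagonal {S : Matrix (Fin n) (Fin n) ℝ} (hS : S.PosDef)
    {B : Matrix (Fin n) (Fin n) ℝ} (hB : IsUnit B) {v : Fin n → ℝ} (h : B * S * Bᵀ = diagonal v)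
    (i : Fin n) : 0 < v i := by
  have := posDef_congruence hS (vecMul_injective_iff_isUnit.2 hB)
  rw [h] at this
  exact posDef_diagonal_iff.1 this i

theorem transpose_eq_of_posDef {S : Matrix (Fin n) (Fin n) ℝ} (hS : S.PosDef) : Sᵀ = S := by
  rw [← conjTranspose_eq_transpose_of_trivial]
  exact hS.isHermitian

theorem transpose_sqrt (S : Matrix (Fin n) (Fin n) ℝ) : (CFC.sqrt S)ᵀ = CFC.sqrt S := by
  rw [← conjTranspose_eq_transpose_of_trivial]
  exact (nonneg_iff_posSemidef.1 (CFC.sqrt_nonneg S)).isHermitian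

theorem sqrt_mul_sqrt_of_posDef {S : Matrix (Fin n) (Fin n) ℝ} (hS : S.PosDef) :
    CFC.sqrt S * CFC.sqrt S = S :=
  CFC.sqrt_mul_sqrt_self S hS.posSemidef.nonneg

theorem isUnit_det_sqrt {S : Matrix (Fin n) (Fin n) ℝ} (hS : S.PosDef) :
    IsUnit (CFC.sqrt S).det := by
  have h := (isUnit_iff_isUnit_det _).1 hS.isUnit
  rw [← sqrt_mul_sqrt_of_posDef hS, det_mul] at h
  exact isUnit_of_mul_isUnit_left h

/-- Two positive definite matrices can be diagonalized simultaneously by a congruence. -/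
theorem exists_simultaneous_diagonalization {S₁ S₂ : Matrix (Fin n) (Fin n) ℝ}
    (hS₁ : S₁.PosDef) (hS₂ : S₂.PosDef) :
    ∃ (B : Matrix (Fin n) (Fin n) ℝ) (v : Fin n → ℝ), IsUnit B ∧ Antitone v ∧
      B * S₂ * Bᵀ = 1 ∧ B * S₁ * Bᵀ = diagonal v := by
  have hTT := sqrt_mul_sqrt_of_posDef hS₂
  have hTt := transpose_sqrt S₂
  have hTu := isUnit_det_sqrt hS₂
  set T := CFC.sqrt S₂
  have hH : (T⁻¹ * S₁ * T⁻¹).IsHermitian := by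
    rw [IsHermitian, conjTranspose_eq_transpose_of_trivial]
    simp only [transpose_mul, transpose_nonsing_inv, hTt, transpose_eq_of_posDef hS₁,
      Matrix.mul_assoc]
  set U : Matrix (Fin n) (Fin n) ℝ := hH.eigenvectorUnitary.1
  have hUU : Uᵀ * U = 1 := by
    have := Unitary.coe_star_mul_self hH.eigenvectorUnitary
    rwa [star_eq_conjTranspose, conjTranspose_eq_transpose_of_trivial] at this
  have hspec : Uᵀ * (T⁻¹ * S₁ * T⁻¹) * U = diagonal hH.eigenvalues := by
    have h := hH.spectral_theorem
    rw [Unitary.conjStarAlgAut_apply, star_eq_conjTranspose,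
      conjTranspose_eq_transpose_of_trivial] at h
    refine (congrArg (fun X => Uᵀ * X * U) h).trans ?_
    calc Uᵀ * (U * diagonal (RCLike.ofReal ∘ hH.eigenvalues) * Uᵀ) * U
        = (Uᵀ * U) * diagonal (RCLike.ofReal ∘ hH.eigenvalues) * (Uᵀ * U) := by
          simp only [Matrix.mul_assoc]
      _ = diagonal hH.eigenvalues := by rw [hUU, Matrix.one_mul, Matrix.mul_one]; rfl
  -- Sorting the negated eigenvalues puts the eigenvalues in decreasing order.
  set τ := Tuple.sort (fun i => -hH.eigenvalues i)
  have hUu : IsUnit Uᵀ := (isUnit_iff_isUnit_det _).2 (isUnit_det_of_right_inverse hUU)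
  have hTi : IsUnit T⁻¹ := (isUnit_iff_isUnit_det _).2 (isUnit_nonsing_inv_det _ hTu)
  have hsub : ∀ X : Matrix (Fin n) (Fin n) ℝ,
      ((Uᵀ * T⁻¹).submatrix τ id) * X * ((Uᵀ * T⁻¹).submatrix τ id)ᵀ
        = (Uᵀ * (T⁻¹ * X * T⁻¹) * U).submatrix τ τ := by
    intro X
    have e : Uᵀ * (T⁻¹ * X * T⁻¹) * U = (Uᵀ * T⁻¹) * X * (Uᵀ * T⁻¹)ᵀ := by
      simp only [transpose_mul, transpose_nonsing_inv, hTt, transpose_transpose, Matrix.mul_assoc]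
    rw [e, transpose_submatrix]
    rfl
  refine ⟨(Uᵀ * T⁻¹).submatrix τ id, hH.eigenvalues ∘ τ, ?_, ?_, ?_, ?_⟩
  · exact (isUnit_submatrix_equiv τ (Equiv.refl _)).2 (hUu.mul hTi)
  · intro i j hij
    have := Tuple.monotone_sort (fun i => -hH.eigenvalues i) hij
    simpa using this
  · rw [hsub, ← hTT, nonsing_inv_mul_cancel_left _ _ hTu, mul_nonsing_inv _ hTu, Matrix.mul_one,
      hUU, submatrix_one_equiv]
  · rw [hsub, hspec, submatrix_diagonal_equiv]

theorem exists_isEigendecomposition {S₁ S₂ : Matrix (Fin n) (Fin n) ℝ}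
    (hS₁ : S₁.PosDef) (hS₂ : S₂.PosDef) :
    ∃ (Q : Matrix (Fin n) (Fin n) ℝ) (v : Fin n → ℝ), IsEigendecomposition S₁ S₂ Q v := by
  obtain ⟨B, v, hB, -, h2, h1⟩ := exists_simultaneous_diagonalization hS₁ hS₂
  have hd : IsUnit B.det := (isUnit_iff_isUnit_det B).1 hB
  have hdt : IsUnit Bᵀ.det := by rwa [det_transpose]
  refine ⟨B⁻¹, v, (isUnit_iff_isUnit_det _).2 (isUnit_nonsing_inv_det _ hd), ?_⟩
  have h2' : S₂⁻¹ = Bᵀ * B := by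
    apply inv_eq_left_inv
    have h : B * (S₂ * Bᵀ) = 1 := by rw [← Matrix.mul_assoc, h2]
    have h3 := mul_eq_one_comm.1 h
    rw [Matrix.mul_assoc] at h3
    have h4 := mul_eq_one_comm.1 h3
    exact h4
  rw [nonsing_inv_nonsing_inv _ hd, h2', ← h1]
  simp only [Matrix.mul_assoc]
  rw [nonsing_inv_mul_cancel_left _ _ hd]

theorem posDef_whitened {S₂ Q : Matrix (Fin n) (Fin n) ℝ} (hS₂ : S₂.PosDef) (hQ : IsUnit Q) :
    (Q⁻¹ * S₂ * Q⁻¹ᵀ).PosDef :=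
  posDef_congruence hS₂ (vecMul_injective_iff_isUnit.2 (isUnit_nonsing_inv_iff.2 hQ))

theorem isUnit_diagTransform {S₂ Q : Matrix (Fin n) (Fin n) ℝ} (hS₂ : S₂.PosDef)
    (hQ : IsUnit Q) : IsUnit (diagTransform S₂ Q) :=
  (isUnit_nonsing_inv_iff.2 ((isUnit_iff_isUnit_det _).2
    (isUnit_det_sqrt (posDef_whitened hS₂ hQ)))).mul (isUnit_nonsing_inv_iff.2 hQ)

/-- Let `W = Q⁻¹ S₂ Q⁻ᵀ`. Then `Q⁻¹ S₁ Q⁻ᵀ = Λ W` is symmetric, so `W` and hence its square root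
commute with `Λ`. This also covers repeated eigenvalues, where `W` need not be diagonal. -/
theorem diagTransform_congruence {S₁ S₂ Q : Matrix (Fin n) (Fin n) ℝ} {v : Fin n → ℝ}
    (hS₁ : S₁.PosDef) (hS₂ : S₂.PosDef) (h : IsEigendecomposition S₁ S₂ Q v) :
    diagTransform S₂ Q * S₂ * (diagTransform S₂ Q)ᵀ = 1 ∧
      diagTransform S₂ Q * S₁ * (diagTransform S₂ Q)ᵀ = diagonal v := by
  obtain ⟨hQ, hS⟩ := h
  have hTT := sqrt_mul_sqrt_of_posDef (posDef_whitened hS₂ hQ)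
  have hTu := isUnit_det_sqrt (posDef_whitened hS₂ hQ)
  have hQd : IsUnit Q.det := (isUnit_iff_isUnit_det _).1 hQ
  have hS₂d : IsUnit S₂.det := (isUnit_iff_isUnit_det _).1 hS₂.isUnit
  have hcong : ∀ X, diagTransform S₂ Q * X * (diagTransform S₂ Q)ᵀ
      = (CFC.sqrt (Q⁻¹ * S₂ * Q⁻¹ᵀ))⁻¹ * (Q⁻¹ * X * Q⁻¹ᵀ) * (CFC.sqrt (Q⁻¹ * S₂ * Q⁻¹ᵀ))⁻¹ := by
    intro X
    rw [diagTransform]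
    rw [transpose_mul, transpose_nonsing_inv (CFC.sqrt _), transpose_sqrt]
    simp only [Matrix.mul_assoc]
  have hΛ : Q⁻¹ * S₁ * Q⁻¹ᵀ = diagonal v * (Q⁻¹ * S₂ * Q⁻¹ᵀ) := by
    have e : S₁ = Q * diagonal v * Q⁻¹ * S₂ := by
      rw [← hS, nonsing_inv_mul_cancel_right _ _ hS₂d]
    rw [e]
    simp only [Matrix.mul_assoc]
    rw [nonsing_inv_mul_cancel_left _ _ hQd]
  have hsymm : ∀ {X : Matrix (Fin n) (Fin n) ℝ}, X.PosDef → (Q⁻¹ * X * Q⁻¹ᵀ)ᵀ = Q⁻¹ * X * Q⁻¹ᵀ := by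
    intro X hX
    simp only [transpose_mul, transpose_transpose, transpose_eq_of_posDef hX, Matrix.mul_assoc]
  have hcomm : Commute (Q⁻¹ * S₂ * Q⁻¹ᵀ) (diagonal v) := by
    have h1 := hsymm hS₁
    rw [hΛ, transpose_mul, hsymm hS₂, diagonal_transpose] at h1
    exact h1
  have hcommT : Commute (CFC.sqrt (Q⁻¹ * S₂ * Q⁻¹ᵀ)) (diagonal v) :=
    Commute.cfcₙ_nnreal hcomm _
  rw [hcong, hcong, hΛ]
  set T := CFC.sqrt (Q⁻¹ * S₂ * Q⁻¹ᵀ)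
  rw [← hTT]
  constructor
  · rw [nonsing_inv_mul_cancel_left _ _ hTu, mul_nonsing_inv _ hTu]
  · rw [← Matrix.mul_assoc (diagonal v), ← hcommT.eq, Matrix.mul_assoc T,
      nonsing_inv_mul_cancel_left _ _ hTu, mul_nonsing_inv_cancel_right _ _ hTu]

end Diagonalization

/-! ### Cauchy interlacing -/

section Interlacing

/-- Cauchy interlacing: a compression of a diagonal matrix with decreasing entries has its `i`-th
largest eigenvalue at most the `i`-th largest entry. -/
theorem compression_eigenvalue_le {r N : ℕ} (hr : r ≤ N) {a : Fin N → ℝ} {b : Fin r → ℝ}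
    (ha : Antitone a) (hb : Antitone b) {C : Matrix (Fin r) (Fin N) ℝ} (h1 : C * Cᵀ = 1)
    (hd : C * diagonal a * Cᵀ = diagonal b) (i : Fin r) : b i ≤ a (Fin.castLE hr i) := by
  -- A kernel vector `y` meets `r - 1` linear conditions: `y` vanishes after position `i` and `y ᵥ*
  -- C` before it. A nonzero one exists by dimension, and its quadratic form is compared with `b i`
  -- and with `a i`.
  let f : (Fin r → ℝ) →ₗ[ℝ] ({p : Fin r // p ≠ i} → ℝ) := LinearMap.pi fun p =>
    if p.1 < i then (LinearMap.proj (Fin.castLE hr p.1)).comp C.vecMulLinear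
    else LinearMap.proj p.1
  have hfin : Module.finrank ℝ ({p : Fin r // p ≠ i} → ℝ) < Module.finrank ℝ (Fin r → ℝ) := by
    have := i.pos
    simp
    omega
  obtain ⟨y, hy, hy0⟩ := (Submodule.ne_bot_iff _).1
    (LinearMap.ker_ne_bot_of_finrank_lt (f := f) hfin)
  rw [LinearMap.mem_ker] at hy
  have hlt : ∀ p < i, (y ᵥ* C) (Fin.castLE hr p) = 0 := by
    intro p hp
    simpa [f, hp] using congrFun hy ⟨p, hp.ne⟩
  have hgt : ∀ p, i < p → y p = 0 := by
    intro p hp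
    simpa [f, hp.not_gt] using congrFun hy ⟨p, hp.ne'⟩
  have hquad : ∀ X : Matrix (Fin N) (Fin N) ℝ,
      y ᵥ* (C * X * Cᵀ) ⬝ᵥ y = (y ᵥ* C) ᵥ* X ⬝ᵥ (y ᵥ* C) := by
    intro X
    rw [← vecMul_vecMul, ← vecMul_vecMul, vecMul_transpose, dotProduct_comm, dotProduct_mulVec,
      dotProduct_comm]
  have hnorm : y ⬝ᵥ y = (y ᵥ* C) ⬝ᵥ (y ᵥ* C) := by
    have := hquad 1
    rwa [Matrix.mul_one, h1, vecMul_one, vecMul_one] at this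
  have hform : ∑ p, b p * y p ^ 2 = ∑ j, a j * (y ᵥ* C) j ^ 2 := by
    have := hquad (diagonal a)
    rw [hd] at this
    simp only [dotProduct, vecMul_diagonal] at this
    convert this using 2 <;> ring
  have hpos : 0 < y ⬝ᵥ y := by
    have h := dotProduct_star_self_pos_iff.2 hy0
    rwa [star_trivial] at h
  have hlow : b i * (y ⬝ᵥ y) ≤ ∑ p, b p * y p ^ 2 := by
    rw [dotProduct, Finset.mul_sum]
    refine Finset.sum_le_sum fun p _ => ?_
    rcases le_or_gt p i with hp | hp
    · rw [← sq]
      exact mul_le_mul_of_nonneg_right (hb hp) (sq_nonneg _)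
    · simp [hgt p hp]
  have hupp : ∑ j, a j * (y ᵥ* C) j ^ 2 ≤ a (Fin.castLE hr i) * ((y ᵥ* C) ⬝ᵥ (y ᵥ* C)) := by
    rw [dotProduct, Finset.mul_sum]
    refine Finset.sum_le_sum fun j _ => ?_
    rcases le_or_gt (Fin.castLE hr i) j with hj | hj
    · rw [← sq]
      exact mul_le_mul_of_nonneg_right (ha hj) (sq_nonneg _)
    · have hji : (j : ℕ) < i := hj
      have := hlt ⟨j, hji.trans i.2⟩ hji
      rw [show Fin.castLE hr ⟨j, hji.trans i.2⟩ = j from rfl] at this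
      simp [this]
  rw [← hnorm, ← hform] at hupp
  exact le_of_mul_le_mul_right (hlow.trans hupp) hpos

/-- Cauchy interlacing from below: the `i`-th smallest eigenvalue of the compression is at least the
`i`-th smallest entry. -/
theorem le_compression_eigenvalue {r N : ℕ} (hr : r ≤ N) {a : Fin N → ℝ} {b : Fin r → ℝ}
    (ha : Antitone a) (hb : Antitone b) {C : Matrix (Fin r) (Fin N) ℝ} (h1 : C * Cᵀ = 1)
    (hd : C * diagonal a * Cᵀ = diagonal b) (i : Fin r) :
    a (Fin.castLE hr i.rev).rev ≤ b i := by
  have hC : ∀ X : Matrix (Fin N) (Fin N) ℝ,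
      C.submatrix Fin.revPerm Fin.revPerm * X.submatrix Fin.revPerm Fin.revPerm
        * (C.submatrix Fin.revPerm Fin.revPerm)ᵀ
        = (C * X * Cᵀ).submatrix Fin.revPerm Fin.revPerm := by
    intro X
    rw [transpose_submatrix, submatrix_mul_equiv, submatrix_mul_equiv]
  -- Negating the entries and reversing the order turns the lower bound into the upper one.
  have h := compression_eigenvalue_le hr (a := fun j => -a j.rev) (b := fun j => -b j.rev)
    (fun j k hjk => neg_le_neg (ha (Fin.rev_le_rev.2 hjk)))
    (fun j k hjk => neg_le_neg (hb (Fin.rev_le_rev.2 hjk)))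
    (C := C.submatrix Fin.revPerm Fin.revPerm) (by
      have := hC 1
      rwa [submatrix_one_equiv, Matrix.mul_one, Matrix.mul_one, h1, submatrix_one_equiv] at this)
    (by
      have := hC (-diagonal a)
      rw [Matrix.mul_neg, Matrix.neg_mul, hd, diagonal_neg, diagonal_neg,
        submatrix_diagonal_equiv, submatrix_diagonal_equiv] at this
      exact this) i.rev
  simpa using h

end Interlacing

/-! ### Matching projected eigenvalues with extreme ones -/

section Selection

theorem one_lt_iff_lt_countGtOne {n : ℕ} {b : Fin n → ℝ} (hb : Antitone b) (i : Fin n) :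
    1 < b i ↔ (i : ℕ) < countGtOne b := by
  constructor
  · intro hi
    have : Finset.Iic i ⊆ Finset.univ.filter fun i => 1 < b i := fun p hp =>
      Finset.mem_filter.2 ⟨Finset.mem_univ _, hi.trans_le (hb (Finset.mem_Iic.1 hp))⟩
    have := Finset.card_le_card this
    rw [Fin.card_Iic] at this
    exact this
  · intro hi
    by_contra h
    have : (Finset.univ.filter fun i => 1 < b i) ⊆ Finset.Iio i := fun p hp =>
      Finset.mem_Iio.2 (lt_of_not_ge fun hip => h ((Finset.mem_filter.1 hp).2.trans_le (hb hip)))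
    have := Finset.card_le_card this
    rw [Fin.card_Iio] at this
    exact absurd hi this.not_gt

theorem countGtOne_le {n : ℕ} (b : Fin n → ℝ) : countGtOne b ≤ n :=
  (Finset.card_filter_le _ _).trans (by simp)

theorem countGtOne_comp_perm {n : ℕ} (b : Fin n → ℝ) (σ : Equiv.Perm (Fin n)) :
    countGtOne (fun i => b (σ i)) = countGtOne b :=
  Finset.card_equiv σ (by simp)

theorem endsIndex_injective {M N : ℕ} (hM : M ≤ N) (k : ℕ) :
    Function.Injective (endsIndex hM k) := by
  intro i j h
  rw [Fin.ext_iff] at h ⊢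
  unfold endsIndex at h
  split_ifs at h <;> simp at h <;> omega

variable {r M N : ℕ} {a : Fin N → ℝ} {b : Fin r → ℝ}

/-- The last two properties leave room for the entries of `b` above one among the first `k` places
and for the rest among the last `M - k`. Interlacing makes them compatible with the bounds on `k`:
it gives `countGtOne b ≤ countGtOne a` and the analogous inequality for the entries at most one. -/
theorem exists_admissible_cut (hM : M ≤ N) (hr : r ≤ M) (ha : Antitone a) (hb : Antitone b)
    (hle : ∀ i, b i ≤ a (Fin.castLE (hr.trans hM) i))
    (hge : ∀ i : Fin r, a (Fin.castLE (hr.trans hM) i.rev).rev ≤ b i) :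
    ∃ k ≤ M, M + countGtOne a ≤ k + N ∧ k ≤ countGtOne a ∧
      (∀ i : Fin r, 1 < b i → (i : ℕ) < k) ∧ ∀ i : Fin r, b i ≤ 1 → k ≤ M - r + i := by
  have hja : countGtOne b ≤ countGtOne a := by
    by_contra! h
    have hi := h.trans_le (countGtOne_le b)
    have h1 := (one_lt_iff_lt_countGtOne hb ⟨_, hi⟩).2 h
    exact lt_irrefl _ ((one_lt_iff_lt_countGtOne ha _).1 (h1.trans_le (hle _)))
  have hjN : r + countGtOne a ≤ N + countGtOne b := by
    by_contra! h
    have hi : countGtOne b < r := by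
      have := countGtOne_le a
      omega
    have h1 := mt (one_lt_iff_lt_countGtOne hb ⟨_, hi⟩).1 (lt_irrefl _)
    have h2 := mt (one_lt_iff_lt_countGtOne ha _).2 fun h3 => h1 (h3.trans_le (hge _))
    simp only [Fin.val_rev, Fin.val_castLE] at h2
    omega
  have := countGtOne_le a
  have := countGtOne_le b
  -- This is the least cut meeting both lower bounds; truncated subtraction is harmless inside the
  -- maximum.
  refine ⟨max (countGtOne b) (M + countGtOne a - N), by omega, by omega, by omega, ?_, ?_⟩
  · intro i hi
    exact lt_max_of_lt_left ((one_lt_iff_lt_countGtOne hb i).1 hi)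
  · intro i hi
    have := mt (one_lt_iff_lt_countGtOne hb i).2 hi.not_gt
    omega

theorem sum_chernoffExponent_le (hM : M ≤ N) (hr : r ≤ M) (ha : ∀ i, 0 < a i) (hb : ∀ i, 0 < b i)
    (hle : ∀ i, b i ≤ a (Fin.castLE (hr.trans hM) i))
    (hge : ∀ i : Fin r, a (Fin.castLE (hr.trans hM) i.rev).rev ≤ b i) {k : ℕ}
    (hk : ∀ i : Fin r, 1 < b i → (i : ℕ) < k) (hk' : ∀ i : Fin r, b i ≤ 1 → k ≤ M - r + i)
    {l : ℝ} (hl : l ∈ Set.Icc (0 : ℝ) 1) :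
    ∑ i, chernoffExponent l (b i) ≤ ∑ i, chernoffExponent l (a (endsIndex hM k i)) := by
  -- Entries above one are aligned with the start, the others with the end; `hk` and `hk'` keep the
  -- two images disjoint. Each partner is at least as far from one on the same side, and unmatched
  -- places contribute nonnegative terms.
  let φ : Fin r → Fin M := fun i =>
    if 1 < b i then Fin.castLE hr i else ⟨M - r + i, by omega⟩
  have hφ : Function.Injective φ := by
    intro i j h
    have hi := hk i
    have hj := hk j
    have hi' := hk' i
    have hj' := hk' j
    rw [Fin.ext_iff] at h ⊢
    simp only [φ] at h
    split_ifs at h with h1 h2 h2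
    · exact h
    · have := hi h1
      have := hj' (not_lt.1 h2)
      simp at h
      omega
    · have := hj h2
      have := hi' (not_lt.1 h1)
      simp at h
      omega
    · simpa using h
  have hpt : ∀ i, chernoffExponent l (b i) ≤ chernoffExponent l (a (endsIndex hM k (φ i))) := by
    intro i
    apply chernoffExponent_mono hl (hb i) (ha _)
    by_cases h1 : 1 < b i
    · have e : endsIndex hM k (φ i) = Fin.castLE (hr.trans hM) i := by
        simp [φ, h1, endsIndex, hk i h1, Fin.ext_iff]
      rw [e]
      exact mul_nonneg (by linarith) (sub_nonneg.2 (hle i))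
    · have h2 := hk' i (not_lt.1 h1)
      have e : endsIndex hM k (φ i) = (Fin.castLE (hr.trans hM) i.rev).rev := by
        simp only [φ, h1, endsIndex, if_false, h2.not_gt, Fin.ext_iff, Fin.val_rev, Fin.val_castLE]
        omega
      rw [e]
      exact mul_nonneg_of_nonpos_of_nonpos (by linarith) (sub_nonpos.2 (hge i))
  calc ∑ i, chernoffExponent l (b i)
      ≤ ∑ i, chernoffExponent l (a (endsIndex hM k (φ i))) := Finset.sum_le_sum fun i _ => hpt i
    _ = ∑ i ∈ Finset.univ.map ⟨φ, hφ⟩, chernoffExponent l (a (endsIndex hM k i)) := by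
        rw [Finset.sum_map]; rfl
    _ ≤ ∑ i, chernoffExponent l (a (endsIndex hM k i)) :=
        Finset.sum_le_sum_of_subset_of_nonneg (Finset.subset_univ _) fun i _ _ =>
          chernoffExponent_nonneg hl (ha _)

end Selection

/-! ### Comparison of an arbitrary projection with some `A_k` -/

section Projection

variable {r M N : ℕ} {S₁ S₂ P : Matrix (Fin N) (Fin N) ℝ} {v : Fin N → ℝ}

theorem vecMul_injective_of_rank_eq {A : Matrix (Fin r) (Fin N) ℝ} (h : A.rank = r) :
    Function.Injective A.vecMul := by
  rw [vecMul_injective_iff, linearIndependent_iff_card_eq_finrank_span,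
    Fintype.card_fin, Set.finrank, ← rank_eq_finrank_span_row, h]

theorem endsMatrix_congruence (hM : M ≤ N) (σ : Equiv.Perm (Fin N)) (k : ℕ)
    {X : Matrix (Fin N) (Fin N) ℝ} {w : Fin N → ℝ} (h : P * X * Pᵀ = diagonal w) :
    endsMatrix hM P σ k * X * (endsMatrix hM P σ k)ᵀ
      = diagonal fun i => w (σ (endsIndex hM k i)) := by
  have e : endsMatrix hM P σ k * X * (endsMatrix hM P σ k)ᵀ
      = (P * X * Pᵀ).submatrix (fun i => σ (endsIndex hM k i)) fun i => σ (endsIndex hM k i) := rfl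
  rw [e, h]
  exact submatrix_diagonal _ _ (σ.injective.comp (endsIndex_injective hM k))

theorem rank_endsMatrix (hM : M ≤ N) (σ : Equiv.Perm (Fin N)) (k : ℕ) (h : P * S₂ * Pᵀ = 1) :
    (endsMatrix hM P σ k).rank = M := by
  apply le_antisymm (rank_le_height _)
  have h2 := endsMatrix_congruence hM σ k (h.trans diagonal_one.symm)
  rw [diagonal_one, Matrix.mul_assoc] at h2
  have := rank_mul_le_left (endsMatrix hM P σ k) (S₂ * (endsMatrix hM P σ k)ᵀ)
  rwa [h2, rank_one, Fintype.card_fin] at this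

theorem projectedChernoffInfo_endsMatrix (hM : M ≤ N) (σ : Equiv.Perm (Fin N)) (k : ℕ)
    (h2 : P * S₂ * Pᵀ = 1) (h1 : P * S₁ * Pᵀ = diagonal v) :
    projectedChernoffInfo S₁ S₂ (endsMatrix hM P σ k)
      = chernoffInfo (diagonal fun i => v (σ (endsIndex hM k i))) 1 := by
  rw [projectedChernoffInfo, endsMatrix_congruence hM σ k h1,
    endsMatrix_congruence hM σ k (h2.trans diagonal_one.symm), diagonal_one]

/-- Each projection is dominated by one onto extreme generalized eigendirections. -/
theorem exists_projectedChernoffInfo_le (hM : M ≤ N) (hr : r ≤ M) (hS₁ : S₁.PosDef)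
    (hS₂ : S₂.PosDef) (hP : IsUnit P) (h2 : P * S₂ * Pᵀ = 1) (h1 : P * S₁ * Pᵀ = diagonal v)
    {σ : Equiv.Perm (Fin N)} (hσ : Antitone fun i => v (σ i)) {A : Matrix (Fin r) (Fin N) ℝ}
    (hA : A.rank = r) :
    ∃ k ≤ M, M + countGtOne v ≤ k + N ∧ k ≤ countGtOne v ∧
      projectedChernoffInfo S₁ S₂ A ≤ projectedChernoffInfo S₁ S₂ (endsMatrix hM P σ k) := by
  have hinj := vecMul_injective_of_rank_eq hA
  have hA₁ := posDef_congruence hS₁ hinj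
  obtain ⟨B, b, hB, hb, hB2, hB1⟩ :=
    exists_simultaneous_diagonalization hA₁ (posDef_congruence hS₂ hinj)
  have hb0 := pos_of_congruence_eq_diagonal hA₁ hB hB1
  have hv0 := pos_of_congruence_eq_diagonal hS₁ hP h1
  have hPd := (isUnit_iff_isUnit_det _).1 hP
  -- `C` is the whitened projection in sorted eigencoordinates: its rows are orthonormal, and it
  -- compresses the sorted `Λ` to `diagonal b`.
  set C := (B * A * P⁻¹).submatrix id σ with hC
  have hCX : ∀ X, C * (P * X * Pᵀ).submatrix σ σ * Cᵀ = B * (A * X * Aᵀ) * Bᵀ := by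
    intro X
    have e : B * A = B * A * P⁻¹ * P := (nonsing_inv_mul_cancel_right _ _ hPd).symm
    calc C * (P * X * Pᵀ).submatrix σ σ * Cᵀ
        = (B * A * P⁻¹) * (P * X * Pᵀ) * (B * A * P⁻¹)ᵀ := by
          rw [hC, transpose_submatrix, submatrix_mul_equiv, submatrix_mul_equiv, submatrix_id_id]
      _ = (B * A * P⁻¹ * P) * X * (B * A * P⁻¹ * P)ᵀ := by
          rw [transpose_mul _ P]; simp only [Matrix.mul_assoc]
      _ = B * (A * X * Aᵀ) * Bᵀ := by
          rw [← e, transpose_mul]; simp only [Matrix.mul_assoc]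
  have hC1 : C * Cᵀ = 1 := by
    have := hCX S₂
    rwa [h2, submatrix_one_equiv, Matrix.mul_one, hB2] at this
  have hCd : C * diagonal (fun i => v (σ i)) * Cᵀ = diagonal b := by
    have := hCX S₁
    rwa [h1, submatrix_diagonal_equiv, hB1] at this
  have hle := compression_eigenvalue_le (hr.trans hM) hσ hb hC1 hCd
  have hge := le_compression_eigenvalue (hr.trans hM) hσ hb hC1 hCd
  obtain ⟨k, hkM, hk1, hk2, hk, hk'⟩ := exists_admissible_cut hM hr hσ hb hle hge
  rw [countGtOne_comp_perm] at hk1 hk2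
  refine ⟨k, hkM, hk1, hk2, ?_⟩
  rw [projectedChernoffInfo_endsMatrix hM σ k h2 h1, projectedChernoffInfo,
    ← chernoffInfo_congruence hB, hB1, hB2]
  -- An `l` optimal for `A` need not be optimal for `A_k`, but its exponent there is still a lower
  -- bound.
  obtain ⟨l, hl, hlb⟩ := (isGreatest_chernoffInfo hb0).1
  rw [← hlb]
  refine le_trans ?_ ((isGreatest_chernoffInfo fun i => hv0 _).2 ⟨l, hl, rfl⟩)
  exact mul_le_mul_of_nonneg_left
    (sum_chernoffExponent_le hM hr (fun i => hv0 _) hb0 hle hge hk hk' hl) (by norm_num)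

end Projection

end GaussianDR

theorem mainTheorem5 (N M : ℕ) (hM : M ≤ N) (S₁ S₂ : Matrix (Fin N) (Fin N) ℝ)
    (hS₁ : S₁.PosDef) (hS₂ : S₂.PosDef) :
    (∃ (Q : Matrix (Fin N) (Fin N) ℝ) (lam : Fin N → ℝ),
      GaussianDR.IsEigendecomposition S₁ S₂ Q lam) ∧
    ∀ (Q : Matrix (Fin N) (Fin N) ℝ) (lam : Fin N → ℝ),
      GaussianDR.IsEigendecomposition S₁ S₂ Q lam →
      (GaussianDR.diagTransform S₂ Q * S₂ * (GaussianDR.diagTransform S₂ Q).transpose = 1 ∧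
        GaussianDR.diagTransform S₂ Q * S₁ * (GaussianDR.diagTransform S₂ Q).transpose
          = Matrix.diagonal lam) ∧
      ∀ σ : Equiv.Perm (Fin N), Antitone (fun i => lam (σ i)) →
        ∃ k : ℕ, k ≤ M ∧ M + GaussianDR.countGtOne lam ≤ k + N ∧ k ≤ GaussianDR.countGtOne lam ∧
          (GaussianDR.endsMatrix hM (GaussianDR.diagTransform S₂ Q) σ k).rank = M ∧
          ∀ (r : ℕ), r ≤ M → ∀ A : Matrix (Fin r) (Fin N) ℝ, A.rank = r →
            GaussianDR.projectedChernoffInfo S₁ S₂ A ≤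
              GaussianDR.projectedChernoffInfo S₁ S₂
                (GaussianDR.endsMatrix hM (GaussianDR.diagTransform S₂ Q) σ k) := by
  refine ⟨GaussianDR.exists_isEigendecomposition hS₁ hS₂, fun Q lam hQ => ?_⟩
  obtain ⟨h2, h1⟩ := GaussianDR.diagTransform_congruence hS₁ hS₂ hQ
  refine ⟨⟨h2, h1⟩, fun σ hσ => ?_⟩
  have hP := GaussianDR.isUnit_diagTransform hS₂ hQ.1
  let K := (Finset.range (M + 1)).filter fun k =>
    M + GaussianDR.countGtOne lam ≤ k + N ∧ k ≤ GaussianDR.countGtOne lam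
  have hdom : ∀ r ≤ M, ∀ A : Matrix (Fin r) (Fin N) ℝ, A.rank = r → ∃ k ∈ K,
      GaussianDR.projectedChernoffInfo S₁ S₂ A ≤ GaussianDR.projectedChernoffInfo S₁ S₂
        (GaussianDR.endsMatrix hM (GaussianDR.diagTransform S₂ Q) σ k) := by
    intro r hr A hA
    obtain ⟨k, hkM, hk1, hk2, hk⟩ :=
      GaussianDR.exists_projectedChernoffInfo_le hM hr hS₁ hS₂ hP h2 h1 hσ hA
    exact ⟨k, Finset.mem_filter.2 ⟨Finset.mem_range.2 (by omega), hk1, hk2⟩, hk⟩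
  have hK : K.Nonempty := by
    -- The empty projection, of rank zero, already yields an admissible cut.
    obtain ⟨k, hk, -⟩ := hdom 0 (Nat.zero_le _) 0 (by simp)
    exact ⟨k, hk⟩
  obtain ⟨k, hkK, hkmax⟩ := Finset.exists_max_image K (fun k =>
    GaussianDR.projectedChernoffInfo S₁ S₂
      (GaussianDR.endsMatrix hM (GaussianDR.diagTransform S₂ Q) σ k)) hK
  obtain ⟨hkM, hk1, hk2⟩ := Finset.mem_filter.1 hkK
  refine ⟨k, Nat.lt_succ_iff.1 (Finset.mem_range.1 hkM), hk1, hk2,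
    GaussianDR.rank_endsMatrix hM σ k h2, fun r hr A hA => ?_⟩
  obtain ⟨k', hk'K, hk'⟩ := hdom r hr A hA
  exact hk'.trans (hkmax k' hk'K)
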